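/- **Theorem 2.1.** Let $T>0$, let $\Omega$ be the space of continuous functions $\omega:[0,T]\to\mathbb R$ with $\omega_0=0$, endowed with the uniform norm and its Borel $\sigma$-field, and let $B$ be the coordinate process. Let $\bar\mu$ be a nonzero finite measure on $[0,T]$ such that $t\mapsto\bar\mu_t:=\bar\mu([0,t])$ is continuous. Let $\mathbf P$ be a set of probability measures $P$ on $\Omega$ under each of which $B$ is a martingale for its canonical filtration and the process $\bar\mu-\langle B\rangle^P$ is increasing $P$-almost surely, where $\langle B\rangle^P$ is the quadratic variation of $B$ under $P$. For $f\in C_b(\Omega)$ (the bounded continuous real functions on $\Omega$) put $c(f)=\sup_{P\in\mathbf P}\|f\|_{L^2(P)}$. For lower semicontinuous $f:\Omega\to[0,\infty]$ put $c(f)=\sup\{c(\varphi):\varphi\in C_b(\Omega),\ 0\le\varphi\le f\}$, for arbitrary $g:\Omega\to\mathbb R$ put $c(g)=\inf\{c(f): f \text{ lower semicontinuous},\ f\ge|g|\}$, and for $A\subseteq\Omega$ put $c(A)=c(\mathbf 1_A)$. A set $A$ is polar if $c(A)=0$; a property holds quasi-surely if it holds outside a polar set; $g$ is quasi-continuous if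 for every $\varepsilon>0$ there is an open set $O$ with $c(O)<\varepsilon$ such that $g|_{O^c}$ is continuous. Let $\mathcal L$ be the completion of $C_b(\Omega)$ with respect to the seminorm $c$ (elements at distance zero being identified), with its norm $\|\cdot\|_{\mathcal L}$. Say that $g:\Omega\to\mathbb R$ represents $\xi\in\mathcal L$ if there are $f_n\in C_b(\Omega)$ with $f_n\to\xi$ in $\mathcal L$ and $c(g-f_n)\to0$. Let $L$ be the set of classes, modulo quasi-sure equality, of the functions that represent elements of $\mathcal L$. Then: 1. Every $\xi\in\mathcal L$ is represented by a quasi-continuous function. The functions representing $\xi$ form exactly one class $\Phi(\xi)$ modulo quasi-sure equality, and $\xi\mapsto\Phi(\xi)$ is a linear bijection of $\mathcal L$ onto $L$. 2. The functional $c$ is finite and depends only on the class on $L$, it is a norm on $L$, and $c(\Phi(\xi))=\|\xi\|_{\mathcal L}$ for all $\xi\in\mathcal L$. 3. $(L,c)$ is a Banach space. -/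

import Mathlib

open MeasureTheory Filter Topology Set
open scoped ENNReal NNReal BoundedContinuousFunction

noncomputable section

namespace ModelUncertainty

/-! ## The path space and martingale measures -/

/-- The path space `Ω`: continuous functions `ω : [0, T] → ℝ` with `ω 0 = 0`. -/
def PathSpace (T : ℝ) : Type :=
  {ω : C(Set.Icc (0 : ℝ) T, ℝ) // ∀ t : Set.Icc (0 : ℝ) T, (t : ℝ) = 0 → ω t = 0}

/-- `Ω` carries the metric of the uniform norm. -/
instance (T : ℝ) : MetricSpace (PathSpace T) :=
  inferInstanceAs (MetricSpace
    {ω : C(Set.Icc (0 : ℝ) T, ℝ) // ∀ t : Set.Icc (0 : ℝ) T, (t : ℝ) = 0 → ω t = 0})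

/-- `Ω` carries its Borel σ-field. -/
instance (T : ℝ) : MeasurableSpace (PathSpace T) := borel (PathSpace T)

instance (T : ℝ) : BorelSpace (PathSpace T) := ⟨rfl⟩

/-- The coordinate process `B`. -/
def coord {T : ℝ} (t : Set.Icc (0 : ℝ) T) (ω : PathSpace T) : ℝ := ω.1 t

theorem continuous_coord {T : ℝ} (t : Set.Icc (0 : ℝ) T) :
    Continuous (coord t : PathSpace T → ℝ) :=
  (continuous_eval_const t).comp continuous_subtype_val

theorem stronglyMeasurable_coord {T : ℝ} (t : Set.Icc (0 : ℝ) T) :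
    StronglyMeasurable (coord t : PathSpace T → ℝ) :=
  (continuous_coord t).measurable.stronglyMeasurable

/-- The canonical filtration: `ℱ t` is generated by `B s`, `s ≤ t`. -/
def canonicalFiltration (T : ℝ) :
    Filtration (Set.Icc (0 : ℝ) T) (inferInstance : MeasurableSpace (PathSpace T)) :=
  Filtration.natural coord stronglyMeasurable_coord

/-- `P` is a martingale measure: `B` is a martingale under `P` for the canonical filtration. -/
def IsMartingaleMeasure {T : ℝ} (P : ProbabilityMeasure (PathSpace T)) : Prop :=
  Martingale coord (canonicalFiltration T) (P : Measure (PathSpace T))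

/-- `A` is (a version of) the quadratic variation `⟨B⟩^P` of `B` under `P`: `P`-almost surely it is
a continuous increasing process started at `0`, and for each `t` the sums of squared increments of
`B` along subdivisions `s 0 ≤ s 1 ≤ … ≤ s N` of `[0, t]` converge in `P`-probability to `A t`
as the mesh tends to `0`. -/
structure IsQuadraticVariation {T : ℝ} (P : ProbabilityMeasure (PathSpace T))
    (A : Set.Icc (0 : ℝ) T → PathSpace T → ℝ) : Prop where
  ae_path : ∀ᵐ ω ∂(P : Measure (PathSpace T)),
    (∀ t : Set.Icc (0 : ℝ) T, (t : ℝ) = 0 → A t ω = 0) ∧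
      Continuous (fun t => A t ω) ∧ Monotone (fun t => A t ω)
  tendsto : ∀ t : Set.Icc (0 : ℝ) T, ∀ ε : ℝ, 0 < ε → ∃ δ : ℝ, 0 < δ ∧
    ∀ (N : ℕ) (s : ℕ → Set.Icc (0 : ℝ) T), Monotone s → (s 0 : ℝ) = 0 → s N = t →
      (∀ i < N, (s (i + 1) : ℝ) - s i < δ) →
        (P : Measure (PathSpace T))
          {ω | ε ≤ |∑ i ∈ Finset.range N, (coord (s (i + 1)) ω - coord (s i) ω) ^ 2 - A t ω|}
            ≤ ENNReal.ofReal ε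

/-- The domination `d⟨B⟩^P ≤ dμ`: the process `μ([0, t]) - ⟨B⟩^P t` is increasing, `P`-a.s. -/
def BracketDominated {T : ℝ} (P : ProbabilityMeasure (PathSpace T))
    (μ : Measure (Set.Icc (0 : ℝ) T)) : Prop :=
  ∃ A, IsQuadraticVariation P A ∧
    ∀ᵐ ω ∂(P : Measure (PathSpace T)), Monotone (fun t => μ.real (Set.Iic t) - A t ω)

/-! ## The capacity -/

set_option linter.unusedSectionVars false

section Capacity

variable {Ω : Type*} [MetricSpace Ω] [MeasurableSpace Ω] [BorelSpace Ω]

/-- `c(f) = sup {‖f‖_{L²(P)} : P ∈ 𝔓}` for a bounded continuous `f` (a number in `[0, ∞)`). -/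
def capCb (𝔓 : Set (ProbabilityMeasure Ω)) (f : Ω →ᵇ ℝ) : ℝ≥0∞ :=
  ⨆ P ∈ 𝔓, eLpNorm f 2 (P : Measure Ω)

/-- `c(f) = sup {c(φ) : φ ∈ C_b(Ω), 0 ≤ φ ≤ f}`, used for lower semicontinuous `f ≥ 0`. -/
def capLsc (𝔓 : Set (ProbabilityMeasure Ω)) (f : Ω → ℝ≥0∞) : ℝ≥0∞ :=
  ⨆ (φ : Ω →ᵇ ℝ) (_ : ∀ ω, 0 ≤ φ ω) (_ : ∀ ω, ENNReal.ofReal (φ ω) ≤ f ω), capCb 𝔓 φ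

/-- `c(g) = inf {c(f) : f lower semicontinuous, f ≥ g}` for arbitrary `g : Ω → [0, ∞]`. -/
def cap (𝔓 : Set (ProbabilityMeasure Ω)) (g : Ω → ℝ≥0∞) : ℝ≥0∞ :=
  ⨅ (f : Ω → ℝ≥0∞) (_ : LowerSemicontinuous f) (_ : ∀ ω, g ω ≤ f ω), capLsc 𝔓 f

/-- The capacity `c(g) = c(|g|)` of an arbitrary function `g : Ω → ℝ`. -/
def capFun (𝔓 : Set (ProbabilityMeasure Ω)) (g : Ω → ℝ) : ℝ≥0∞ := cap 𝔓 (fun ω => ‖g ω‖ₑ)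

/-- The capacity `c(A) = c(1_A)` of an arbitrary set. -/
def capSet (𝔓 : Set (ProbabilityMeasure Ω)) (A : Set Ω) : ℝ≥0∞ :=
  cap 𝔓 (A.indicator (fun _ => 1))

/-- Polar sets. -/
def IsPolar (𝔓 : Set (ProbabilityMeasure Ω)) (A : Set Ω) : Prop := capSet 𝔓 A = 0

/-- A property holds quasi-surely if it holds outside a polar set. -/
def QuasiSurely (𝔓 : Set (ProbabilityMeasure Ω)) (p : Ω → Prop) : Prop :=
  ∃ A, IsPolar 𝔓 A ∧ ∀ ω ∉ A, p ω

/-- Quasi-continuity: for each `ε > 0` the restriction of `f` to the complement of some open set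
of capacity less than `ε` is continuous. -/
def QuasiContinuous (𝔓 : Set (ProbabilityMeasure Ω)) {E : Type*} [TopologicalSpace E]
    (f : Ω → E) : Prop :=
  ∀ ε : ℝ, 0 < ε → ∃ O : Set Ω, IsOpen O ∧ capSet 𝔓 O < ENNReal.ofReal ε ∧ ContinuousOn f Oᶜ

/-! ### Elementary properties of the capacity -/

theorem capCb_le (𝔓 : Set (ProbabilityMeasure Ω)) (f : Ω →ᵇ ℝ) :
    capCb 𝔓 f ≤ ENNReal.ofReal ‖f‖ := by
  refine iSup₂_le fun P _ => ?_
  have h := eLpNorm_le_of_ae_bound (p := 2) (μ := (P : Measure Ω)) (f := f) (C := ‖f‖)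
    (Eventually.of_forall f.norm_coe_le_norm)
  simpa using h

theorem capCb_ne_top (𝔓 : Set (ProbabilityMeasure Ω)) (f : Ω →ᵇ ℝ) : capCb 𝔓 f ≠ ⊤ :=
  ne_top_of_le_ne_top ENNReal.ofReal_ne_top (capCb_le 𝔓 f)

theorem capCb_add_le (𝔓 : Set (ProbabilityMeasure Ω)) (f g : Ω →ᵇ ℝ) :
    capCb 𝔓 (f + g) ≤ capCb 𝔓 f + capCb 𝔓 g := by
  refine iSup₂_le fun P hP => ?_
  refine (eLpNorm_add_le f.continuous.aestronglyMeasurable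
    g.continuous.aestronglyMeasurable (by norm_num)).trans ?_
  exact add_le_add (le_iSup₂ (f := fun (P : ProbabilityMeasure Ω) (_ : P ∈ 𝔓) =>
      eLpNorm f 2 (P : Measure Ω)) P hP)
    (le_iSup₂ (f := fun (P : ProbabilityMeasure Ω) (_ : P ∈ 𝔓) =>
      eLpNorm g 2 (P : Measure Ω)) P hP)

theorem capCb_smul (𝔓 : Set (ProbabilityMeasure Ω)) (a : ℝ) (f : Ω →ᵇ ℝ) :
    capCb 𝔓 (a • f) = ‖a‖ₑ * capCb 𝔓 f := by
  simp only [capCb, ENNReal.mul_iSup]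
  refine iSup_congr fun P => iSup_congr fun _ => ?_
  exact eLpNorm_const_smul a f 2 (P : Measure Ω)

theorem cap_mono (𝔓 : Set (ProbabilityMeasure Ω)) {g h : Ω → ℝ≥0∞} (H : ∀ ω, g ω ≤ h ω) :
    cap 𝔓 g ≤ cap 𝔓 h :=
  iInf_mono fun _ => iInf_mono fun _ => iInf_mono' fun hf => ⟨fun ω => (H ω).trans (hf ω), le_rfl⟩

theorem capSet_mono (𝔓 : Set (ProbabilityMeasure Ω)) {A B : Set Ω} (H : A ⊆ B) :
    capSet 𝔓 A ≤ capSet 𝔓 B :=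
  cap_mono 𝔓 fun ω => Set.indicator_le_indicator_of_subset H (fun _ => zero_le) ω

/-- Lipschitz minorants of a lower semicontinuous function. -/
def lipMinorant (f : Ω → ℝ≥0∞) (n : ℕ) (x : Ω) : ℝ≥0∞ :=
  ⨅ y, (min (f y) n + n * edist x y)

theorem lipMinorant_le (f : Ω → ℝ≥0∞) (n : ℕ) (x : Ω) : lipMinorant f n x ≤ min (f x) n :=
  (iInf_le _ x).trans (by simp)

theorem lipMinorant_mono (f : Ω → ℝ≥0∞) (x : Ω) : Monotone (fun n => lipMinorant f n x) := by
  intro m n h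
  have h' : (m : ℝ≥0∞) ≤ n := by exact_mod_cast h
  exact iInf_mono fun y => by gcongr

theorem lipMinorant_continuous (f : Ω → ℝ≥0∞) (n : ℕ) : Continuous (lipMinorant f n) := by
  refine continuous_of_le_add_edist n (by simp) fun x y => ?_
  rw [lipMinorant, lipMinorant, ENNReal.iInf_add]
  refine iInf_mono fun z => ?_
  rw [add_assoc, ← mul_add]
  gcongr
  rw [add_comm]
  exact edist_triangle x y z

theorem iSup_lipMinorant {f : Ω → ℝ≥0∞} (hf : LowerSemicontinuous f) (x : Ω) :
    ⨆ n, lipMinorant f n x = f x := by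
  refine le_antisymm (iSup_le fun n => (lipMinorant_le f n x).trans (min_le_left _ _)) ?_
  refine le_of_forall_lt fun a ha => ?_
  obtain ⟨b, hab, hb⟩ := exists_between ha
  have hbt : b ≠ ⊤ := ne_top_of_lt hb
  obtain ⟨r, hr, hball⟩ := EMetric.mem_nhds_iff.1 (hf x b hb)
  obtain ⟨n₁, hn₁⟩ := ENNReal.exists_nat_gt hbt
  obtain ⟨n₂, hn₂⟩ := ENNReal.exists_nat_mul_gt hr.ne' hbt
  refine hab.trans_le (le_iSup_of_le (max n₁ n₂) (le_iInf fun y => ?_))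
  by_cases hy : edist x y < r
  · have h1 : b < f y := hball (by rwa [Metric.mem_eball, edist_comm])
    refine le_add_right (le_min h1.le (hn₁.le.trans ?_))
    exact_mod_cast le_max_left n₁ n₂
  · refine le_add_left (hn₂.le.trans ?_)
    have h3 : (n₂ : ℝ≥0∞) ≤ (max n₁ n₂ : ℕ) := by exact_mod_cast le_max_right n₁ n₂
    gcongr
    exact not_lt.1 hy

theorem eLpNorm_le_capLsc {𝔓 : Set (ProbabilityMeasure Ω)} {P : ProbabilityMeasure Ω}
    (hP : P ∈ 𝔓) {f : Ω → ℝ≥0∞} (hf : LowerSemicontinuous f) :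
    eLpNorm f 2 (P : Measure Ω) ≤ capLsc 𝔓 f := by
  have hlt : ∀ n x, lipMinorant f n x ≠ ⊤ := fun n x =>
    ne_top_of_le_ne_top (ENNReal.natCast_ne_top n) ((lipMinorant_le f n x).trans (min_le_right _ _))
  have key : ∀ n, eLpNorm (lipMinorant f n) 2 (P : Measure Ω) ≤ capLsc 𝔓 f := by
    intro n
    let φ : Ω →ᵇ ℝ := BoundedContinuousFunction.ofNormedAddCommGroup
      (fun x => (lipMinorant f n x).toReal)
      (ENNReal.continuousOn_toReal.comp_continuous (lipMinorant_continuous f n) (hlt n))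
      n (fun x => by
        rw [Real.norm_of_nonneg ENNReal.toReal_nonneg]
        exact ENNReal.toReal_le_of_le_ofReal (by positivity)
          (by simpa using (lipMinorant_le f n x).trans (min_le_right _ _)))
    have hφ : ∀ x, φ x = (lipMinorant f n x).toReal := fun x => rfl
    have h1 : capCb 𝔓 φ ≤ capLsc 𝔓 f :=
      le_iSup_of_le φ (le_iSup₂_of_le (fun x => by rw [hφ]; positivity)
        (fun x => by
          rw [hφ, ENNReal.ofReal_toReal (hlt n x)]
          exact (lipMinorant_le f n x).trans (min_le_left _ _)) le_rfl)
    refine le_trans (le_of_eq ?_) ((le_iSup₂ (f := fun (P : ProbabilityMeasure Ω) (_ : P ∈ 𝔓) =>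
      eLpNorm φ 2 (P : Measure Ω)) P hP).trans h1)
    refine eLpNorm_congr_enorm_ae (Eventually.of_forall fun x => ?_)
    rw [hφ, Real.enorm_of_nonneg ENNReal.toReal_nonneg, ENNReal.ofReal_toReal (hlt n x), enorm_eq_self]
  rw [eLpNorm_eq_lintegral_rpow_enorm_toReal (by norm_num) (by norm_num)]
  simp only [enorm_eq_self, ENNReal.toReal_ofNat]
  have hsup : ∀ x, f x ^ (2 : ℝ) = ⨆ n, lipMinorant f n x ^ (2 : ℝ) := by
    intro x
    rw [← iSup_lipMinorant hf x]
    exact (ENNReal.orderIsoRpow 2 (by norm_num)).map_iSup _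
  simp only [hsup]
  rw [lintegral_iSup (fun n => (lipMinorant_continuous f n).measurable.pow_const _)
    (fun m n h x => ENNReal.rpow_le_rpow (lipMinorant_mono f x h) (by norm_num))]
  have := (ENNReal.orderIsoRpow (1 / 2) (by norm_num)).map_iSup
    (fun n => ∫⁻ x, lipMinorant f n x ^ (2 : ℝ) ∂(P : Measure Ω))
  simp only [ENNReal.orderIsoRpow_apply] at this
  rw [this]
  refine iSup_le fun n => ?_
  have h := key n
  rw [eLpNorm_eq_lintegral_rpow_enorm_toReal (by norm_num) (by norm_num)] at h
  simpa only [enorm_eq_self, ENNReal.toReal_ofNat] using h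

theorem capLsc_add_le (𝔓 : Set (ProbabilityMeasure Ω)) {f g : Ω → ℝ≥0∞}
    (hf : LowerSemicontinuous f) (hg : LowerSemicontinuous g) :
    capLsc 𝔓 (fun ω => f ω + g ω) ≤ capLsc 𝔓 f + capLsc 𝔓 g := by
  refine iSup_le fun φ => iSup₂_le fun h0 hφ => iSup₂_le fun P hP => ?_
  calc eLpNorm φ 2 (P : Measure Ω) ≤ eLpNorm (f + g) 2 (P : Measure Ω) :=
        eLpNorm_mono_enorm fun x => by
          rw [Real.enorm_of_nonneg (h0 x), enorm_eq_self]; exact hφ x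
    _ ≤ eLpNorm f 2 (P : Measure Ω) + eLpNorm g 2 (P : Measure Ω) :=
        eLpNorm_add_le hf.measurable.aestronglyMeasurable hg.measurable.aestronglyMeasurable
          (by norm_num)
    _ ≤ _ := add_le_add (eLpNorm_le_capLsc hP hf) (eLpNorm_le_capLsc hP hg)

theorem cap_add_le (𝔓 : Set (ProbabilityMeasure Ω)) (g h : Ω → ℝ≥0∞) :
    cap 𝔓 (fun ω => g ω + h ω) ≤ cap 𝔓 g + cap 𝔓 h := by
  conv_rhs => rw [cap, cap]
  simp only [ENNReal.iInf_add, ENNReal.add_iInf]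
  refine le_iInf fun f₂ => le_iInf fun hf₂ => le_iInf fun hh => ?_
  refine le_iInf fun f₁ => le_iInf fun hf₁ => le_iInf fun hg => ?_
  refine (iInf_le_of_le (fun ω => f₁ ω + f₂ ω) ?_)
  exact (iInf₂_le (hf₁.add hf₂) fun ω => add_le_add (hg ω) (hh ω)).trans (capLsc_add_le 𝔓 hf₁ hf₂)

theorem capFun_add_le (𝔓 : Set (ProbabilityMeasure Ω)) (g h : Ω → ℝ) :
    capFun 𝔓 (g + h) ≤ capFun 𝔓 g + capFun 𝔓 h :=
  (cap_mono 𝔓 fun ω => enorm_add_le (g ω) (h ω)).trans (cap_add_le 𝔓 _ _)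

theorem capLsc_zero (𝔓 : Set (ProbabilityMeasure Ω)) : capLsc 𝔓 (fun _ => 0) = 0 := by
  refine le_antisymm (iSup_le fun φ => iSup₂_le fun h0 hφ => iSup₂_le fun P _ => ?_) zero_le
  have : (φ : Ω → ℝ) = 0 := by
    funext x
    exact le_antisymm (by simpa using hφ x) (h0 x)
  simp [this]

theorem capFun_zero (𝔓 : Set (ProbabilityMeasure Ω)) : capFun 𝔓 0 = 0 :=
  le_antisymm ((iInf_le_of_le (fun _ => 0)
    (iInf₂_le lowerSemicontinuous_const fun ω => by simp)).trans (capLsc_zero 𝔓).le) zero_le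

theorem capLsc_smul_le (𝔓 : Set (ProbabilityMeasure Ω)) {a : ℝ} (ha : 0 < a) (f : Ω → ℝ≥0∞) :
    capLsc 𝔓 (fun ω => ENNReal.ofReal a * f ω) ≤ ENNReal.ofReal a * capLsc 𝔓 f := by
  refine iSup_le fun φ => iSup₂_le fun h0 hφ => ?_
  have hφ' : φ = a • (a⁻¹ • φ) := by rw [smul_smul, mul_inv_cancel₀ ha.ne', one_smul]
  rw [hφ', capCb_smul, Real.enorm_of_nonneg ha.le]
  gcongr
  refine le_iSup_of_le (a⁻¹ • φ) (le_iSup₂_of_le (fun ω => ?_) (fun ω => ?_) le_rfl)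
  · exact mul_nonneg (inv_nonneg.2 ha.le) (h0 ω)
  · have : (a⁻¹ • φ) ω = a⁻¹ * φ ω := rfl
    rw [this, ENNReal.ofReal_mul (inv_nonneg.2 ha.le), ENNReal.ofReal_inv_of_pos ha]
    refine (mul_le_mul_right (hφ ω) _).trans ?_
    rw [← mul_assoc, ENNReal.inv_mul_cancel (by simpa using ha) ENNReal.ofReal_ne_top, one_mul]

theorem capFun_smul_le (𝔓 : Set (ProbabilityMeasure Ω)) (a : ℝ) (g : Ω → ℝ) :
    capFun 𝔓 (a • g) ≤ ‖a‖ₑ * capFun 𝔓 g := by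
  rcases eq_or_ne a 0 with rfl | ha
  · simp [capFun_zero]
  have ha' : 0 < |a| := abs_pos.2 ha
  have e : ‖a‖ₑ = ENNReal.ofReal |a| := Real.enorm_eq_ofReal_abs a
  have h0 : ENNReal.ofReal |a| ≠ 0 := by simpa using ha
  have ht : ENNReal.ofReal |a| ≠ ⊤ := ENNReal.ofReal_ne_top
  rw [e]
  conv_rhs => rw [capFun, cap]
  simp only [ENNReal.mul_iInf_of_ne h0 ht]
  refine le_iInf fun f => le_iInf fun hf => le_iInf fun hg => ?_
  refine iInf_le_of_le (fun ω => ENNReal.ofReal |a| * f ω) ?_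
  refine (iInf₂_le ?_ fun ω => ?_).trans (capLsc_smul_le 𝔓 ha' f)
  · exact (ENNReal.continuous_const_mul ht).comp_lowerSemicontinuous hf
      (fun x y h => mul_le_mul_right h _)
  · change ‖a * g ω‖ₑ ≤ ENNReal.ofReal |a| * f ω
    rw [enorm_mul, e]
    exact mul_le_mul_right (hg ω) _

theorem IsPolar.mono {𝔓 : Set (ProbabilityMeasure Ω)} {A B : Set Ω} (hB : IsPolar 𝔓 B)
    (h : A ⊆ B) : IsPolar 𝔓 A :=
  le_antisymm ((capSet_mono 𝔓 h).trans hB.le) zero_le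

theorem IsPolar.union {𝔓 : Set (ProbabilityMeasure Ω)} {A B : Set Ω} (hA : IsPolar 𝔓 A)
    (hB : IsPolar 𝔓 B) : IsPolar 𝔓 (A ∪ B) := by
  refine le_antisymm ?_ zero_le
  refine (cap_mono 𝔓 (h := fun ω => A.indicator (fun _ => 1) ω + B.indicator (fun _ => 1) ω)
    fun ω => ?_).trans ((cap_add_le 𝔓 _ _).trans ?_)
  · by_cases h1 : ω ∈ A <;> by_cases h2 : ω ∈ B <;> simp [h1, h2]
  · change capSet 𝔓 A + capSet 𝔓 B ≤ 0
    rw [show capSet 𝔓 A = 0 from hA, show capSet 𝔓 B = 0 from hB, add_zero]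

theorem isPolar_empty (𝔓 : Set (ProbabilityMeasure Ω)) : IsPolar 𝔓 ∅ := by
  have := capFun_zero 𝔓
  simpa [IsPolar, capSet, capFun] using this

/-! ## The completion `𝓛` of `C_b(Ω)` and its quotient `L` -/

/-- `C_b(Ω)`, to be normed by the capacity instead of the uniform norm. -/
def CbCap (_𝔓 : Set (ProbabilityMeasure Ω)) : Type _ := Ω →ᵇ ℝ

instance (𝔓 : Set (ProbabilityMeasure Ω)) : AddCommGroup (CbCap 𝔓) :=
  inferInstanceAs (AddCommGroup (Ω →ᵇ ℝ))

instance (𝔓 : Set (ProbabilityMeasure Ω)) : Module ℝ (CbCap 𝔓) :=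
  inferInstanceAs (Module ℝ (Ω →ᵇ ℝ))

instance (𝔓 : Set (ProbabilityMeasure Ω)) : CoeFun (CbCap 𝔓) (fun _ => Ω → ℝ) :=
  ⟨fun f => (show Ω →ᵇ ℝ from f)⟩

/-- The seminorm `c` on `C_b(Ω)`. -/
instance (𝔓 : Set (ProbabilityMeasure Ω)) : Norm (CbCap 𝔓) := ⟨fun f => (capCb 𝔓 f).toReal⟩

theorem capSeminormCore (𝔓 : Set (ProbabilityMeasure Ω)) :
    SeminormedSpace.Core ℝ (CbCap 𝔓) where
  norm_nonneg _ := ENNReal.toReal_nonneg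
  norm_smul a f := by
    change (capCb 𝔓 (a • (show Ω →ᵇ ℝ from f))).toReal = ‖a‖ * (capCb 𝔓 f).toReal
    rw [capCb_smul, ENNReal.toReal_mul, toReal_enorm]
  norm_triangle f g := by
    change (capCb 𝔓 ((show Ω →ᵇ ℝ from f) + (show Ω →ᵇ ℝ from g))).toReal ≤ _
    refine (ENNReal.toReal_mono (ENNReal.add_ne_top.2 ⟨capCb_ne_top 𝔓 _, capCb_ne_top 𝔓 _⟩)
      (capCb_add_le 𝔓 _ _)).trans ?_
    rw [ENNReal.toReal_add (capCb_ne_top 𝔓 _) (capCb_ne_top 𝔓 _)]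
    exact le_rfl

instance (𝔓 : Set (ProbabilityMeasure Ω)) : SeminormedAddCommGroup (CbCap 𝔓) :=
  SeminormedAddCommGroup.ofCore (capSeminormCore 𝔓)

instance (𝔓 : Set (ProbabilityMeasure Ω)) : NormedSpace ℝ (CbCap 𝔓) where
  norm_smul_le a f := ((capSeminormCore 𝔓).norm_smul a f).le

/-- `𝓛`: the completion of `C_b(Ω)` with respect to the seminorm `c`. -/
abbrev CapCompletion (𝔓 : Set (ProbabilityMeasure Ω)) : Type _ :=
  UniformSpace.Completion (CbCap 𝔓)

/-- The function `g` represents the element `ξ` of `𝓛`: some sequence in `C_b(Ω)` converges to `ξ`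
in `𝓛` and converges to `g` in capacity norm, i.e. `c(g - f n) → 0`. -/
def Represents (𝔓 : Set (ProbabilityMeasure Ω)) (ξ : CapCompletion 𝔓) (g : Ω → ℝ) : Prop :=
  ∃ f : ℕ → CbCap 𝔓, Tendsto (fun n => (f n : CapCompletion 𝔓)) atTop (𝓝 ξ) ∧
    Tendsto (fun n => capFun 𝔓 (fun ω => g ω - f n ω)) atTop (𝓝 0)

/-- The functions on `Ω` that vanish quasi-surely. -/
def qsNull (𝔓 : Set (ProbabilityMeasure Ω)) : Submodule ℝ (Ω → ℝ) where
  carrier := {g | QuasiSurely 𝔓 fun ω => g ω = 0}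
  zero_mem' := ⟨∅, isPolar_empty 𝔓, fun _ _ => rfl⟩
  add_mem' := by
    rintro g h ⟨A, hA, hg⟩ ⟨B, hB, hh⟩
    refine ⟨A ∪ B, hA.union hB, fun ω hω => ?_⟩
    rw [Set.mem_union, not_or] at hω
    simp [hg ω hω.1, hh ω hω.2]
  smul_mem' := by
    rintro a g ⟨A, hA, hg⟩
    exact ⟨A, hA, fun ω hω => by simp [hg ω hω]⟩

/-- Functions on `Ω` up to quasi-sure equality. -/
abbrev QSFun (𝔓 : Set (ProbabilityMeasure Ω)) : Type _ := (Ω → ℝ) ⧸ qsNull 𝔓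

/-- The class of a function up to quasi-sure equality. -/
def qsClass (𝔓 : Set (ProbabilityMeasure Ω)) (g : Ω → ℝ) : QSFun 𝔓 := (qsNull 𝔓).mkQ g

/-- `L`: the classes, up to quasi-sure equality, of the functions representing elements of `𝓛`. -/
def CapL (𝔓 : Set (ProbabilityMeasure Ω)) : Submodule ℝ (QSFun 𝔓) where
  carrier := {x | ∃ ξ g, Represents 𝔓 ξ g ∧ qsClass 𝔓 g = x}
  zero_mem' := by
    refine ⟨0, 0, ⟨fun _ => 0, ?_, ?_⟩, map_zero _⟩
    · simp only [UniformSpace.Completion.coe_zero]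
      exact tendsto_const_nhds
    · have : (fun _ : ℕ => capFun 𝔓 fun ω : Ω => (0 : Ω → ℝ) ω - (0 : Ω →ᵇ ℝ) ω) = fun _ => 0 := by
        funext n
        rw [← capFun_zero 𝔓]
        congr 1
        funext ω
        simp
      exact this ▸ tendsto_const_nhds
  add_mem' := by
    rintro _ _ ⟨ξ, g, ⟨f, hf, hg⟩, rfl⟩ ⟨η, h, ⟨k, hk, hh⟩, rfl⟩
    refine ⟨ξ + η, g + h, ⟨fun n => f n + k n, ?_, ?_⟩, map_add _ _ _⟩
    · simp only [UniformSpace.Completion.coe_add]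
      exact hf.add hk
    · have hs := hg.add hh
      rw [add_zero] at hs
      refine tendsto_of_tendsto_of_tendsto_of_le_of_le tendsto_const_nhds hs (fun _ => zero_le)
        fun n => ?_
      refine le_trans (le_of_eq ?_) (capFun_add_le 𝔓 _ _)
      congr 1
      funext ω
      change g ω + h ω - (f n ω + k n ω) = (g ω - f n ω) + (h ω - k n ω)
      ring
  smul_mem' := by
    rintro a _ ⟨ξ, g, ⟨f, hf, hg⟩, rfl⟩
    refine ⟨a • ξ, a • g, ⟨fun n => a • f n, ?_, ?_⟩, map_smul _ _ _⟩
    · simp only [UniformSpace.Completion.coe_smul]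
      exact hf.const_smul a
    · have hs := ENNReal.Tendsto.const_mul (a := ‖a‖ₑ) hg (Or.inr enorm_ne_top)
      rw [mul_zero] at hs
      refine tendsto_of_tendsto_of_tendsto_of_le_of_le tendsto_const_nhds hs (fun _ => zero_le)
        fun n => ?_
      refine le_trans (le_of_eq ?_) (capFun_smul_le 𝔓 a _)
      congr 1
      funext ω
      change a * g ω - a * f n ω = a * (g ω - f n ω)
      ring

/-- The functional `c` on `L`. (The infimum is over all functions in the class; that they all have
the same capacity is not part of the definition.) -/
instance (𝔓 : Set (ProbabilityMeasure Ω)) : Norm (CapL 𝔓) :=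
  ⟨fun x => (⨅ (g : Ω → ℝ) (_ : qsClass 𝔓 g = x), capFun 𝔓 g).toReal⟩

end Capacity

end ModelUncertainty

end

/-!
The capacity `c` is countably subadditive: on lower semicontinuous functions it is the supremum of
the `L²(P)`-norms, each of which is countably subadditive by monotone convergence, and the general
case follows by choosing lower semicontinuous majorants (`cap_tsum_le`). The rest of the argument is
the classical proof of the Riesz–Fischer theorem, with `c` in place of an `L²`-norm, and works for
every set of probability measures on every metric space.

* Countable subadditivity applied to `∞ · |g|` gives `c(g) = 0` if and only if `g = 0` quasi-surely
  (`capFun_eq_zero_iff`), so that limits in capacity are unique quasi-surely, and `c` depends only on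
  the quasi-sure class.
* On `C_b(Ω)` the functional `c` is the seminorm that was completed
  (`capFun_coe`), hence a function representing `ξ` has capacity `‖ξ‖` (`Represents.capFun_eq`),
  and a function represents at most one `ξ` (`Represents.eq`).
* Each `ξ` is the limit of a sequence `f n` in `C_b(Ω)` whose successive differences have capacity
  at most `4⁻ⁿ`. By Chebyshev's inequality the open set on which the `n`-th difference exceeds
  `2⁻ⁿ` has capacity at most `2⁻ⁿ`. Off the union of these sets over `n ≥ N`, the sequence
  converges uniformly, so its pointwise limit is quasi-continuous, and countable subadditivity shows
  that it represents `ξ` (`exists_quasiContinuous_represents`).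

Thus `ξ ↦` (class of the functions representing `ξ`) is an isometric linear bijection from the
completion onto `L`, through which `L` inherits the norm axioms and completeness.
-/

open MeasureTheory Filter Topology Set
open scoped ENNReal NNReal BoundedContinuousFunction

namespace ModelUncertainty

/-! ### Countable subadditivity of the capacity -/

theorem eLpNorm_two_iSup {α : Type*} [MeasurableSpace α] (P : Measure α) {f : ℕ → α → ℝ≥0∞}
    (hf : ∀ n, Measurable (f n)) (hmono : Monotone f) :
    eLpNorm (fun x => ⨆ n, f n x) 2 P = ⨆ n, eLpNorm (f n) 2 P := by
  simp only [eLpNorm_eq_lintegral_rpow_enorm_toReal (p := 2) (by norm_num) (by norm_num),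
    enorm_eq_self, ENNReal.toReal_ofNat]
  have hsup : ∀ x, (⨆ n, f n x) ^ (2 : ℝ) = ⨆ n, f n x ^ (2 : ℝ) := fun x =>
    (ENNReal.orderIsoRpow 2 (by norm_num)).map_iSup _
  simp only [hsup]
  rw [lintegral_iSup (fun n => (hf n).pow_const _)
    (fun m n h x => ENNReal.rpow_le_rpow (hmono h x) (by norm_num))]
  exact (ENNReal.orderIsoRpow (1 / 2) (by norm_num)).map_iSup _

theorem eLpNorm_two_tsum_le {α : Type*} [MeasurableSpace α] (P : Measure α) {f : ℕ → α → ℝ≥0∞}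
    (hf : ∀ n, Measurable (f n)) :
    eLpNorm (fun x => ∑' n, f n x) 2 P ≤ ∑' n, eLpNorm (f n) 2 P := by
  simp only [ENNReal.tsum_eq_iSup_nat]
  rw [eLpNorm_two_iSup P (f := fun n x => ∑ i ∈ Finset.range n, f i x)
    (fun n => Finset.measurable_fun_sum _ fun i _ => hf i)
    (fun m n h x => Finset.sum_le_sum_of_subset (Finset.range_mono h))]
  refine iSup_mono fun n => ?_
  have h := eLpNorm_sum_le (p := 2) (μ := P) (s := Finset.range n)
    (fun i _ => (hf i).aestronglyMeasurable) (by norm_num)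
  rwa [Finset.sum_fn] at h

variable {Ω : Type*} [MetricSpace Ω] [MeasurableSpace Ω] {𝔓 : Set (ProbabilityMeasure Ω)}

theorem capFun_sub_comm (g h : Ω → ℝ) : capFun 𝔓 (g - h) = capFun 𝔓 (h - g) := by
  unfold capFun
  congr 1
  funext ω
  exact enorm_sub_rev _ _

variable [BorelSpace Ω]

theorem capLsc_tsum_le {f : ℕ → Ω → ℝ≥0∞} (hf : ∀ n, LowerSemicontinuous (f n)) :
    capLsc 𝔓 (fun ω => ∑' n, f n ω) ≤ ∑' n, capLsc 𝔓 (f n) := by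
  refine iSup_le fun φ => iSup₂_le fun h0 hφ => iSup₂_le fun P hP => ?_
  calc eLpNorm φ 2 (P : Measure Ω) ≤ eLpNorm (fun ω => ∑' n, f n ω) 2 (P : Measure Ω) :=
        eLpNorm_mono_enorm fun x => by
          rw [Real.enorm_of_nonneg (h0 x), enorm_eq_self]; exact hφ x
    _ ≤ ∑' n, eLpNorm (f n) 2 (P : Measure Ω) :=
        eLpNorm_two_tsum_le _ fun n => (hf n).measurable
    _ ≤ _ := ENNReal.tsum_le_tsum fun n => eLpNorm_le_capLsc hP (hf n)

theorem cap_tsum_le (g : ℕ → Ω → ℝ≥0∞) :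
    cap 𝔓 (fun ω => ∑' n, g n ω) ≤ ∑' n, cap 𝔓 (g n) := by
  refine ENNReal.le_of_forall_pos_le_add fun ε hε hfin => ?_
  obtain ⟨δ, hδ, hsum⟩ :=
    ENNReal.exists_pos_sum_of_countable' (ENNReal.coe_pos.2 hε).ne' ℕ
  have key : ∀ n, ∃ f : Ω → ℝ≥0∞, LowerSemicontinuous f ∧ (∀ ω, g n ω ≤ f ω) ∧
      capLsc 𝔓 f ≤ cap 𝔓 (g n) + δ n := by
    intro n
    have hlt : cap 𝔓 (g n) < cap 𝔓 (g n) + δ n :=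
      ENNReal.lt_add_right (ENNReal.ne_top_of_tsum_ne_top hfin.ne n) (hδ n).ne'
    conv_lhs at hlt => rw [cap]
    simp only [iInf_lt_iff] at hlt
    obtain ⟨f, hf, hg, h⟩ := hlt
    exact ⟨f, hf, hg, h.le⟩
  choose f hf hg hc using key
  calc cap 𝔓 (fun ω => ∑' n, g n ω) ≤ capLsc 𝔓 (fun ω => ∑' n, f n ω) :=
        iInf_le_of_le _ (iInf₂_le (lowerSemicontinuous_tsum hf)
          fun ω => ENNReal.tsum_le_tsum fun n => hg n ω)
    _ ≤ ∑' n, capLsc 𝔓 (f n) := capLsc_tsum_le hf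
    _ ≤ ∑' n, (cap 𝔓 (g n) + δ n) := ENNReal.tsum_le_tsum hc
    _ ≤ _ := by rw [ENNReal.tsum_add]; gcongr

theorem capSet_iUnion_le (A : ℕ → Set Ω) : capSet 𝔓 (⋃ n, A n) ≤ ∑' n, capSet 𝔓 (A n) := by
  refine (cap_mono 𝔓 fun ω => ?_).trans (cap_tsum_le fun n => (A n).indicator fun _ => 1)
  by_cases hω : ω ∈ ⋃ n, A n
  · obtain ⟨n, hn⟩ := Set.mem_iUnion.1 hω
    refine le_trans ?_ (ENNReal.le_tsum n)
    rw [Set.indicator_of_mem hω, Set.indicator_of_mem hn]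
  · rw [Set.indicator_of_notMem hω]
    exact zero_le

/-! ### Functions of capacity zero -/

theorem IsPolar.cap_indicator_top {A : Set Ω} (hA : IsPolar 𝔓 A) :
    cap 𝔓 (A.indicator fun _ => ⊤) = 0 := by
  refine le_antisymm ((cap_mono 𝔓 fun ω => ?_).trans
    ((cap_tsum_le fun _ : ℕ => A.indicator fun _ => 1).trans ?_)) zero_le
  · by_cases h : ω ∈ A <;> simp [h]
  · exact (ENNReal.tsum_eq_zero.2 fun _ => hA).le

theorem capFun_eq_zero_iff {g : Ω → ℝ} :
    capFun 𝔓 g = 0 ↔ QuasiSurely 𝔓 fun ω => g ω = 0 := by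
  constructor
  · refine fun h => ⟨{ω | g ω ≠ 0}, ?_, fun ω hω => not_not.1 hω⟩
    refine le_antisymm ((cap_mono 𝔓 fun ω => ?_).trans
      ((cap_tsum_le fun _ : ℕ => fun ω => ‖g ω‖ₑ).trans ?_)) zero_le
    · by_cases hω : g ω = 0
      · simp [hω]
      · rw [ENNReal.tsum_const_eq_top_of_ne_zero (by simpa using hω)]
        exact le_top
    · exact (ENNReal.tsum_eq_zero.2 fun _ => h).le
  · rintro ⟨A, hA, hg⟩
    refine le_antisymm ((cap_mono 𝔓 fun ω => ?_).trans hA.cap_indicator_top.le) zero_le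
    by_cases hω : ω ∈ A
    · simp [hω]
    · simp [hg ω hω]

theorem qsClass_eq_iff {g h : Ω → ℝ} :
    qsClass 𝔓 g = qsClass 𝔓 h ↔ capFun 𝔓 (g - h) = 0 :=
  (Submodule.Quotient.eq _).trans capFun_eq_zero_iff.symm

theorem capFun_le_add_sub (g h : Ω → ℝ) : capFun 𝔓 g ≤ capFun 𝔓 h + capFun 𝔓 (g - h) := by
  simpa using capFun_add_le 𝔓 h (g - h)

theorem capFun_sub_le (g h k : Ω → ℝ) :
    capFun 𝔓 (g - k) ≤ capFun 𝔓 (g - h) + capFun 𝔓 (h - k) := by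
  simpa using capFun_add_le 𝔓 (g - h) (h - k)

theorem capFun_congr {g h : Ω → ℝ} (H : qsClass 𝔓 g = qsClass 𝔓 h) :
    capFun 𝔓 g = capFun 𝔓 h := by
  have h₁ := capFun_le_add_sub (𝔓 := 𝔓) g h
  have h₂ := capFun_le_add_sub (𝔓 := 𝔓) h g
  rw [qsClass_eq_iff.1 H, add_zero] at h₁
  rw [qsClass_eq_iff.1 H.symm, add_zero] at h₂
  exact le_antisymm h₁ h₂

/-- Chebyshev's inequality for the capacity. -/
theorem capSet_lt_enorm_le {a : ℝ≥0} (ha : a ≠ 0) (g : Ω → ℝ) :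
    capSet 𝔓 {ω | (a : ℝ≥0∞) < ‖g ω‖ₑ} ≤ (a : ℝ≥0∞)⁻¹ * capFun 𝔓 g := by
  have e : ‖((a⁻¹ : ℝ≥0) : ℝ)‖ₑ = (a : ℝ≥0∞)⁻¹ := by
    rw [Real.enorm_of_nonneg (a⁻¹).coe_nonneg, ENNReal.ofReal_coe_nnreal, ENNReal.coe_inv ha]
  refine (cap_mono 𝔓 fun ω => ?_).trans ((capFun_smul_le 𝔓 ((a⁻¹ : ℝ≥0) : ℝ) g).trans_eq
    (by rw [e]))
  by_cases hω : (a : ℝ≥0∞) < ‖g ω‖ₑ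
  · rw [Set.indicator_of_mem (s := {ω | (a : ℝ≥0∞) < ‖g ω‖ₑ}) hω, Pi.smul_apply, smul_eq_mul,
      enorm_mul, e, ← ENNReal.inv_mul_cancel (ENNReal.coe_ne_zero.2 ha) ENNReal.coe_ne_top]
    gcongr
  · rw [Set.indicator_of_notMem (s := {ω | (a : ℝ≥0∞) < ‖g ω‖ₑ}) hω]
    exact zero_le

/-! ### The capacity on bounded continuous functions -/

/-- For `f ∈ C_b(Ω)` the majorant `|f|` is itself lower semicontinuous, hence optimal. -/
theorem capFun_boundedContinuous (f : Ω →ᵇ ℝ) : capFun 𝔓 f = capCb 𝔓 f := by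
  have hlsc : LowerSemicontinuous fun ω => ‖f ω‖ₑ := f.continuous.enorm.lowerSemicontinuous
  apply le_antisymm
  · refine (iInf_le_of_le (fun ω => ‖f ω‖ₑ) (iInf₂_le hlsc fun ω => le_rfl)).trans ?_
    refine iSup_le fun φ => iSup₂_le fun h0 hφ => iSup₂_mono fun P _ => ?_
    exact eLpNorm_mono_enorm fun x => by rw [Real.enorm_of_nonneg (h0 x)]; exact hφ x
  · refine le_iInf fun h => le_iInf fun hh => le_iInf fun hfh => iSup₂_le fun P hP => ?_
    exact (eLpNorm_mono_enorm fun x => by simpa using hfh x).trans (eLpNorm_le_capLsc hP hh)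

theorem capFun_coe (f : CbCap 𝔓) : capFun 𝔓 f = ‖f‖ₑ := by
  rw [← ofReal_norm]
  exact (capFun_boundedContinuous f).trans (ENNReal.ofReal_toReal (capCb_ne_top 𝔓 f)).symm

theorem capFun_coe_sub (f k : CbCap 𝔓) : capFun 𝔓 ((f : Ω → ℝ) - k) = edist f k := by
  rw [edist_eq_enorm_sub, ← capFun_coe]
  rfl

/-! ### Functions representing elements of the completion -/

theorem Represents.qsClass_eq {ξ : CapCompletion 𝔓} {g h : Ω → ℝ} (hg : Represents 𝔓 ξ g)
    (hh : Represents 𝔓 ξ h) : qsClass 𝔓 g = qsClass 𝔓 h := by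
  obtain ⟨f, hf, hgf⟩ := hg
  obtain ⟨k, hk, hhk⟩ := hh
  rw [qsClass_eq_iff]
  have hfk : Tendsto (fun n => edist (f n) (k n)) atTop (𝓝 0) := by
    simpa using hf.edist hk
  have hlim := (hgf.add hfk).add hhk
  rw [add_zero, add_zero] at hlim
  refine le_antisymm (ge_of_tendsto' hlim fun n => ?_) zero_le
  refine (capFun_sub_le g (k n) h).trans (add_le_add ((capFun_sub_le g (f n) (k n)).trans ?_) ?_)
  · exact add_le_add le_rfl (capFun_coe_sub _ _).le
  · exact (capFun_sub_comm _ _).le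

theorem Represents.congr {ξ : CapCompletion 𝔓} {g h : Ω → ℝ} (hg : Represents 𝔓 ξ g)
    (H : qsClass 𝔓 h = qsClass 𝔓 g) : Represents 𝔓 ξ h := by
  obtain ⟨f, hf, hgf⟩ := hg
  refine ⟨f, hf, tendsto_of_tendsto_of_tendsto_of_le_of_le tendsto_const_nhds hgf
    (fun _ => zero_le) fun n => ?_⟩
  refine (capFun_sub_le h g (f n)).trans ?_
  rw [qsClass_eq_iff.1 H, zero_add]
  exact le_rfl

theorem Represents.eq {ξ η : CapCompletion 𝔓} {g : Ω → ℝ} (hξ : Represents 𝔓 ξ g)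
    (hη : Represents 𝔓 η g) : ξ = η := by
  obtain ⟨f, hf, hgf⟩ := hξ
  obtain ⟨k, hk, hgk⟩ := hη
  have hfk : Tendsto (fun n => edist (f n) (k n)) atTop (𝓝 (edist ξ η)) := by
    simpa using hf.edist hk
  have hlim := hgf.add hgk
  rw [add_zero] at hlim
  refine edist_le_zero.1 (le_of_tendsto_of_tendsto' hfk hlim fun n => ?_)
  rw [← capFun_coe_sub]
  refine (capFun_sub_le _ g _).trans (add_le_add ?_ le_rfl)
  exact (capFun_sub_comm _ _).le

theorem Represents.capFun_eq {ξ : CapCompletion 𝔓} {g : Ω → ℝ} (h : Represents 𝔓 ξ g) :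
    capFun 𝔓 g = ‖ξ‖ₑ := by
  obtain ⟨f, hf, hgf⟩ := h
  have hn : Tendsto (fun n => ‖f n‖ₑ) atTop (𝓝 ‖ξ‖ₑ) := by
    have := hf.enorm
    simpa only [← ofReal_norm, UniformSpace.Completion.norm_coe] using this
  apply le_antisymm
  · have hlim := hn.add hgf
    rw [add_zero] at hlim
    refine ge_of_tendsto' hlim fun n => ?_
    rw [← capFun_coe]
    exact capFun_le_add_sub _ _
  · have hlim := (tendsto_const_nhds (x := capFun 𝔓 g)).add hgf
    rw [add_zero] at hlim
    refine le_of_tendsto_of_tendsto' hn hlim fun n => ?_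
    rw [← capFun_coe]
    refine (capFun_le_add_sub _ g).trans (add_le_add le_rfl ?_)
    exact (capFun_sub_comm _ _).le

theorem Represents.add {ξ η : CapCompletion 𝔓} {g h : Ω → ℝ} (hg : Represents 𝔓 ξ g)
    (hh : Represents 𝔓 η h) : Represents 𝔓 (ξ + η) (g + h) := by
  obtain ⟨f, hf, hgf⟩ := hg
  obtain ⟨k, hk, hhk⟩ := hh
  refine ⟨fun n => f n + k n, ?_, ?_⟩
  · simp only [UniformSpace.Completion.coe_add]
    exact hf.add hk
  · have hs := hgf.add hhk
    rw [add_zero] at hs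
    refine tendsto_of_tendsto_of_tendsto_of_le_of_le tendsto_const_nhds hs (fun _ => zero_le)
      fun n => le_trans (le_of_eq ?_) (capFun_add_le 𝔓 _ _)
    congr 1
    funext ω
    exact add_sub_add_comm _ _ _ _

theorem Represents.smul {ξ : CapCompletion 𝔓} {g : Ω → ℝ} (a : ℝ) (hg : Represents 𝔓 ξ g) :
    Represents 𝔓 (a • ξ) (a • g) := by
  obtain ⟨f, hf, hgf⟩ := hg
  refine ⟨fun n => a • f n, ?_, ?_⟩
  · simp only [UniformSpace.Completion.coe_smul]
    exact hf.const_smul a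
  · have hs := ENNReal.Tendsto.const_mul (a := ‖a‖ₑ) hgf (Or.inr enorm_ne_top)
    rw [mul_zero] at hs
    refine tendsto_of_tendsto_of_tendsto_of_le_of_le tendsto_const_nhds hs (fun _ => zero_le)
      fun n => le_trans (le_of_eq ?_) (capFun_smul_le 𝔓 a _)
    congr 1
    funext ω
    exact (mul_sub _ _ _).symm

/-! ### Existence of quasi-continuous representatives -/

theorem tsum_two_inv_pow_add (N : ℕ) :
    ∑' n, (2⁻¹ : ℝ≥0∞) ^ (N + n) = 2⁻¹ ^ N * 2 := by
  simp only [pow_add]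
  rw [ENNReal.tsum_mul_left, ENNReal.tsum_geometric, ENNReal.one_sub_inv_two, inv_inv]

theorem tendsto_two_inv_pow_mul_two :
    Tendsto (fun N : ℕ => (2⁻¹ : ℝ≥0∞) ^ N * 2) atTop (𝓝 0) := by
  have h := ENNReal.Tendsto.mul_const (b := 2)
    (ENNReal.tendsto_pow_atTop_nhds_zero_of_lt_one ENNReal.one_half_lt_one)
    (Or.inr ENNReal.ofNat_ne_top)
  simpa using h

/-- Every element of the completion is the limit of a rapidly converging sequence in `C_b(Ω)`. -/
theorem exists_seq_tendsto_edist_le (ξ : CapCompletion 𝔓) :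
    ∃ f : ℕ → CbCap 𝔓, Tendsto (fun n => (f n : CapCompletion 𝔓)) atTop (𝓝 ξ) ∧
      ∀ n, edist (f n) (f (n + 1)) ≤ 2⁻¹ ^ n * 2⁻¹ ^ n := by
  set δ : ℕ → ℝ≥0∞ := fun n => 2⁻¹ ^ n * 2⁻¹ ^ n / 2 with hδ
  have hδ0 : ∀ n, 0 < δ n := fun n => by simp [hδ, ENNReal.div_pos_iff]
  have hδle : ∀ n, δ n ≤ 2⁻¹ ^ n * 2 := fun n => by
    have h1 : (2⁻¹ : ℝ≥0∞) ^ n ≤ 1 := pow_le_one₀ zero_le (by simp)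
    calc δ n ≤ 2⁻¹ ^ n * 2⁻¹ ^ n := ENNReal.half_le_self
      _ ≤ _ := by gcongr; exact h1.trans (by norm_num)
  have hanti : ∀ n, δ (n + 1) ≤ δ n := fun n => by
    have h : (2⁻¹ : ℝ≥0∞) ^ (n + 1) ≤ 2⁻¹ ^ n :=
      pow_le_pow_right_of_le_one' (by simp) n.le_succ
    simp only [hδ]
    gcongr
  have key : ∀ n, ∃ f : CbCap 𝔓, edist ξ f < δ n := fun n => by
    obtain ⟨_, ⟨f, rfl⟩, hf⟩ :=
      EMetric.mem_closure_iff.1 (UniformSpace.Completion.denseRange_coe ξ) _ (hδ0 n)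
    exact ⟨f, hf⟩
  choose f hf using key
  refine ⟨f, ?_, fun n => ?_⟩
  · refine tendsto_iff_edist_tendsto_0.2 (tendsto_of_tendsto_of_tendsto_of_le_of_le
      tendsto_const_nhds tendsto_two_inv_pow_mul_two (fun _ => zero_le) fun n => ?_)
    rw [edist_comm]
    exact (hf n).le.trans (hδle n)
  · calc edist (f n) (f (n + 1))
        = edist (f n : CapCompletion 𝔓) (f (n + 1)) := (UniformSpace.Completion.edist_eq _ _).symm
      _ ≤ edist ξ (f n) + edist ξ (f (n + 1)) := edist_triangle_left _ _ _
      _ ≤ δ n + δ n := add_le_add (hf n).le ((hf (n + 1)).le.trans (hanti n))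
      _ = _ := ENNReal.add_halves _

/-- A sequence of continuous functions whose successive differences have capacity at most `4⁻ⁿ`
converges in capacity to a quasi-continuous function: by Chebyshev's inequality this rate makes the
capacities of the open sets on which `|f n - f (n + 1)| > 2⁻ⁿ` summable. -/
theorem exists_quasiContinuous_limit {f : ℕ → Ω → ℝ} (hcont : ∀ n, Continuous (f n))
    (hf : ∀ n, capFun 𝔓 (f n - f (n + 1)) ≤ 2⁻¹ ^ n * 2⁻¹ ^ n) :
    ∃ g : Ω → ℝ, QuasiContinuous 𝔓 g ∧ ∀ n, capFun 𝔓 (g - f n) ≤ 2⁻¹ ^ n * 2 := by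
  set O : ℕ → Set Ω := fun n => {ω | (2⁻¹ : ℝ≥0∞) ^ n < ‖f n ω - f (n + 1) ω‖ₑ}
  set U : ℕ → Set Ω := fun N => ⋃ n, O (N + n)
  have hOc : ∀ n, capSet 𝔓 (O n) ≤ 2⁻¹ ^ n := fun n => by
    have h0 : (2⁻¹ : ℝ≥0∞) ^ n ≠ 0 := by simp
    have ht : (2⁻¹ : ℝ≥0∞) ^ n ≠ ⊤ := ENNReal.pow_ne_top (by simp)
    have hcoe : ((2⁻¹ ^ n : ℝ≥0) : ℝ≥0∞) = 2⁻¹ ^ n := by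
      rw [ENNReal.coe_pow, ENNReal.coe_inv two_ne_zero, ENNReal.coe_ofNat]
    have hC := capSet_lt_enorm_le (𝔓 := 𝔓) (a := 2⁻¹ ^ n) (by positivity) (f n - f (n + 1))
    rw [hcoe] at hC
    refine hC.trans ((mul_le_mul_right (hf n) _).trans_eq ?_)
    rw [← mul_assoc, ENNReal.inv_mul_cancel h0 ht, one_mul]
  have hUc : ∀ N, capSet 𝔓 (U N) ≤ 2⁻¹ ^ N * 2 := fun N =>
    (capSet_iUnion_le _).trans ((ENNReal.tsum_le_tsum fun n => hOc (N + n)).trans_eq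
      (tsum_two_inv_pow_add N))
  have hUo : ∀ N, IsOpen (U N) := fun N => isOpen_iUnion fun n =>
    isOpen_lt continuous_const ((hcont _).sub (hcont _)).enorm
  have hsmall : ∀ N, ∀ ω ∉ U N, ∀ n, edist (f (N + n) ω) (f (N + (n + 1)) ω) ≤ 2⁻¹ ^ (N + n) := by
    intro N ω hω n
    have h : ω ∉ O (N + n) := fun h => hω (Set.mem_iUnion.2 ⟨n, h⟩)
    rw [edist_eq_enorm_sub]
    exact not_lt.1 h
  -- On the polar set where the sequence diverges, `g` takes an irrelevant value.
  set g : Ω → ℝ := fun ω => limUnder atTop fun n => f n ω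
  have hlim : ∀ N, ∀ ω ∉ U N, Tendsto (fun n => f n ω) atTop (𝓝 (g ω)) := by
    intro N ω hω
    have hcs : CauchySeq fun n => f (N + n) ω :=
      cauchySeq_of_edist_le_of_tsum_ne_top _ (hsmall N ω hω) (by
        rw [tsum_two_inv_pow_add]
        exact ENNReal.mul_ne_top (ENNReal.pow_ne_top (by simp)) (by simp))
    obtain ⟨x, hx⟩ := cauchySeq_tendsto_of_complete hcs
    simp only [Nat.add_comm N] at hx
    exact tendsto_nhds_limUnder ⟨x, (tendsto_add_atTop_iff_nat (f := fun n => f n ω) N).1 hx⟩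
  have hpolar : IsPolar 𝔓 (⋂ N, U N) := le_antisymm
    (ge_of_tendsto' tendsto_two_inv_pow_mul_two fun N =>
      (capSet_mono 𝔓 (Set.iInter_subset U N)).trans (hUc N)) zero_le
  refine ⟨g, fun ε hε => ?_, fun n => ?_⟩
  · obtain ⟨N, hN⟩ := (tendsto_two_inv_pow_mul_two.eventually_lt_const
      (ENNReal.ofReal_pos.2 hε)).exists
    refine ⟨U N, hUo N, (hUc N).trans_lt hN, ?_⟩
    have hunif : TendstoUniformlyOn (fun n ω => f (N + n) ω) g atTop (U N)ᶜ := by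
      rw [EMetric.tendstoUniformlyOn_iff]
      intro δ hδ
      have hev := (tendsto_two_inv_pow_mul_two.comp (tendsto_add_atTop_nat N)).eventually_lt_const hδ
      filter_upwards [hev] with n hn ω hω
      have hl : Tendsto (fun n => f (N + n) ω) atTop (𝓝 (g ω)) := by
        simp only [Nat.add_comm N]
        exact (tendsto_add_atTop_iff_nat (f := fun n => f n ω) N).2 (hlim N ω hω)
      rw [edist_comm]
      refine (edist_le_tsum_of_edist_le_of_tendsto _ (hsmall N ω hω) hl n).trans_lt ?_
      simp only [← add_assoc]
      rw [tsum_two_inv_pow_add, Nat.add_comm N]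
      exact hn
    exact hunif.continuousOn (Frequently.of_forall fun n => (hcont _).continuousOn)
  · have hpt : ∀ ω, ‖g ω - f n ω‖ₑ ≤
        (∑' m, ‖f (n + m) ω - f (n + m + 1) ω‖ₑ) + (⋂ N, U N).indicator (fun _ => ⊤) ω := by
      intro ω
      by_cases hω : ω ∈ ⋂ N, U N
      · simp [Set.indicator_of_mem hω]
      · obtain ⟨N, hN⟩ : ∃ N, ω ∉ U N := by
          rwa [Set.mem_iInter, not_forall] at hω
        rw [Set.indicator_of_notMem hω, add_zero, enorm_sub_rev, ← edist_eq_enorm_sub]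
        simp only [← edist_eq_enorm_sub]
        exact edist_le_tsum_of_edist_le_of_tendsto (fun n => edist (f n ω) (f (n + 1) ω))
          (fun _ => le_rfl) (hlim N ω hN) n
    calc capFun 𝔓 (g - f n)
        ≤ cap 𝔓 (fun ω => ∑' m, ‖f (n + m) ω - f (n + m + 1) ω‖ₑ) + 0 := by
          rw [← hpolar.cap_indicator_top]
          exact (cap_mono 𝔓 hpt).trans (cap_add_le 𝔓 _ _)
      _ ≤ ∑' m, capFun 𝔓 (f (n + m) - f (n + m + 1)) := by
          rw [add_zero]
          exact cap_tsum_le fun m ω => ‖f (n + m) ω - f (n + m + 1) ω‖ₑ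
      _ ≤ ∑' m, 2⁻¹ ^ (n + m) := ENNReal.tsum_le_tsum fun m =>
          (hf _).trans (mul_le_of_le_one_right zero_le (pow_le_one₀ zero_le (by simp)))
      _ = _ := tsum_two_inv_pow_add n

theorem exists_quasiContinuous_represents (ξ : CapCompletion 𝔓) :
    ∃ g : Ω → ℝ, QuasiContinuous 𝔓 g ∧ Represents 𝔓 ξ g := by
  obtain ⟨f, hfξ, hf⟩ := exists_seq_tendsto_edist_le ξ
  obtain ⟨g, hg, hgf⟩ := exists_quasiContinuous_limit (𝔓 := 𝔓) (f := fun n => (f n : Ω → ℝ))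
    (fun n => BoundedContinuousFunction.continuous _)
    (fun n => (capFun_coe_sub (f n) (f (n + 1))).trans_le (hf n))
  exact ⟨g, hg, f, hfξ, tendsto_of_tendsto_of_tendsto_of_le_of_le tendsto_const_nhds
    tendsto_two_inv_pow_mul_two (fun _ => zero_le) hgf⟩

/-! ### The isometry between the completion and `L` -/

theorem exists_represents (ξ : CapCompletion 𝔓) : ∃ g : Ω → ℝ, Represents 𝔓 ξ g :=
  (exists_quasiContinuous_represents ξ).imp fun _ h => h.2

/-- A chosen function representing `ξ`. -/
noncomputable def representative (ξ : CapCompletion 𝔓) : Ω → ℝ := (exists_represents ξ).choose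

theorem represents_representative (ξ : CapCompletion 𝔓) : Represents 𝔓 ξ (representative ξ) :=
  (exists_represents ξ).choose_spec

theorem represents_iff {ξ : CapCompletion 𝔓} {g : Ω → ℝ} :
    Represents 𝔓 ξ g ↔ qsClass 𝔓 g = qsClass 𝔓 (representative ξ) :=
  ⟨fun h => h.qsClass_eq (represents_representative ξ), (represents_representative ξ).congr⟩

/-- The map sending `ξ` to the quasi-sure class of the functions that represent it. -/
noncomputable def completionToCapL (𝔓 : Set (ProbabilityMeasure Ω)) :
    CapCompletion 𝔓 →ₗ[ℝ] CapL 𝔓 where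
  toFun ξ := ⟨qsClass 𝔓 (representative ξ), ξ, _, represents_representative ξ, rfl⟩
  map_add' ξ η := Subtype.ext <| (represents_iff.1
    ((represents_representative ξ).add (represents_representative η))).symm.trans (map_add _ _ _)
  map_smul' a ξ := Subtype.ext <| (represents_iff.1
    ((represents_representative ξ).smul a)).symm.trans (map_smul _ _ _)

theorem completionToCapL_bijective (𝔓 : Set (ProbabilityMeasure Ω)) :
    Function.Bijective (completionToCapL 𝔓) := by
  constructor
  · intro ξ η h
    have h' : qsClass 𝔓 (representative ξ) = qsClass 𝔓 (representative η) :=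
      congrArg Subtype.val h
    exact (represents_representative ξ).eq (represents_iff.2 h')
  · rintro ⟨_, ξ, g, hg, rfl⟩
    exact ⟨ξ, Subtype.ext (represents_iff.1 hg).symm⟩

/-- The linear bijection of the completion onto `L`. -/
noncomputable def completionEquivCapL (𝔓 : Set (ProbabilityMeasure Ω)) :
    CapCompletion 𝔓 ≃ₗ[ℝ] CapL 𝔓 :=
  LinearEquiv.ofBijective (completionToCapL 𝔓) (completionToCapL_bijective 𝔓)

theorem represents_iff_qsClass_eq {ξ : CapCompletion 𝔓} {g : Ω → ℝ} :
    Represents 𝔓 ξ g ↔ qsClass 𝔓 g = completionEquivCapL 𝔓 ξ :=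
  represents_iff

/-- The infimum defining the norm on `L` is over functions that all have the same capacity. -/
theorem norm_capL_eq {x : CapL 𝔓} {g : Ω → ℝ} (hg : qsClass 𝔓 g = x) :
    ‖x‖ = (capFun 𝔓 g).toReal := by
  change (⨅ (h : Ω → ℝ) (_ : qsClass 𝔓 h = x), capFun 𝔓 h).toReal = _
  congr 1
  exact le_antisymm (iInf₂_le g hg)
    (le_iInf₂ fun h hh => (capFun_congr (hg.trans hh.symm)).le)

theorem norm_completionEquivCapL (ξ : CapCompletion 𝔓) : ‖completionEquivCapL 𝔓 ξ‖ = ‖ξ‖ := by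
  have h := represents_representative ξ
  rw [norm_capL_eq (represents_iff_qsClass_eq.1 h), h.capFun_eq, toReal_enorm]

theorem capFun_eq_norm {x : CapL 𝔓} {g : Ω → ℝ} (hg : qsClass 𝔓 g = x) :
    capFun 𝔓 g = ENNReal.ofReal ‖x‖ := by
  obtain ⟨ξ, rfl⟩ := (completionEquivCapL 𝔓).surjective x
  rw [norm_completionEquivCapL, ofReal_norm]
  exact (represents_iff_qsClass_eq.2 hg).capFun_eq

/-- A linear bijection that preserves norms transports the norm axioms. -/
theorem capL_core (𝔓 : Set (ProbabilityMeasure Ω)) : NormedSpace.Core ℝ (CapL 𝔓) := by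
  have hsurj := (completionEquivCapL 𝔓).surjective
  refine ⟨⟨fun x => ?_, fun a x => ?_, fun x y => ?_⟩, fun x => ?_⟩
  · exact ENNReal.toReal_nonneg
  · obtain ⟨ξ, rfl⟩ := hsurj x
    rw [← map_smul, norm_completionEquivCapL, norm_completionEquivCapL, norm_smul]
  · obtain ⟨ξ, rfl⟩ := hsurj x
    obtain ⟨η, rfl⟩ := hsurj y
    rw [← map_add]
    simp only [norm_completionEquivCapL]
    exact norm_add_le ξ η
  · obtain ⟨ξ, rfl⟩ := hsurj x
    rw [norm_completionEquivCapL, norm_eq_zero, LinearEquiv.map_eq_zero_iff]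

theorem completeSpace_capL (𝔓 : Set (ProbabilityMeasure Ω)) :
    @CompleteSpace (CapL 𝔓) (NormedAddCommGroup.ofCore (capL_core 𝔓)).toUniformSpace := by
  let := NormedAddCommGroup.ofCore (capL_core 𝔓)
  have hiso : Isometry (completionEquivCapL 𝔓) :=
    AddMonoidHomClass.isometry_of_norm (completionEquivCapL 𝔓) norm_completionEquivCapL
  exact (hiso.isUniformInducing.completeSpace_congr (completionEquivCapL 𝔓).surjective).1
    inferInstance

end ModelUncertainty

theorem theorem2p1 (T : ℝ) (hT : 0 < T)
    (μ : MeasureTheory.Measure (Set.Icc (0 : ℝ) T)) [MeasureTheory.IsFiniteMeasure μ] (hμ : μ ≠ 0)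
    (hμc : Continuous fun t : Set.Icc (0 : ℝ) T => μ.real (Set.Iic t))
    (𝔓 : Set (MeasureTheory.ProbabilityMeasure (ModelUncertainty.PathSpace T)))
    (h𝔓 : ∀ P ∈ 𝔓, ModelUncertainty.IsMartingaleMeasure P ∧
      ModelUncertainty.BracketDominated P μ) :
    (∃ Φ : ModelUncertainty.CapCompletion 𝔓 ≃ₗ[ℝ] ModelUncertainty.CapL 𝔓,
      (∀ ξ g, ModelUncertainty.Represents 𝔓 ξ g ↔ ModelUncertainty.qsClass 𝔓 g = Φ ξ) ∧
      (∀ ξ, ∃ g : ModelUncertainty.PathSpace T → ℝ, ModelUncertainty.QuasiContinuous 𝔓 g ∧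
        ModelUncertainty.qsClass 𝔓 g = Φ ξ) ∧
      (∀ ξ, ‖Φ ξ‖ = ‖ξ‖)) ∧
    (∀ (x : ModelUncertainty.CapL 𝔓) (g : ModelUncertainty.PathSpace T → ℝ),
      ModelUncertainty.qsClass 𝔓 g = x → ModelUncertainty.capFun 𝔓 g = ENNReal.ofReal ‖x‖) ∧
    (∃ core : NormedSpace.Core ℝ (ModelUncertainty.CapL 𝔓),
      @CompleteSpace (ModelUncertainty.CapL 𝔓)
        (NormedAddCommGroup.ofCore core).toUniformSpace) := by
  refine ⟨⟨ModelUncertainty.completionEquivCapL 𝔓,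
    fun ξ g => ModelUncertainty.represents_iff_qsClass_eq, fun ξ => ?_,
    ModelUncertainty.norm_completionEquivCapL⟩,
    fun x g hg => ModelUncertainty.capFun_eq_norm hg,
    ModelUncertainty.capL_core 𝔓, ModelUncertainty.completeSpace_capL 𝔓⟩
  obtain ⟨g, hg, hξ⟩ := ModelUncertainty.exists_quasiContinuous_represents ξ
  exact ⟨g, hg, ModelUncertainty.represents_iff_qsClass_eq.1 hξ⟩
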